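/- Let $k$ be a field and $X$ a well-ordered set. Order associative words on $X$ by $>_{lex}$, where $u>_{lex}v$ if $u$ is a proper prefix of $v$, or at the first place where $u$ and $v$ differ the letter of $u$ is larger; let $u>_{deg\text{-}lex}v$ mean $|u|>|v|$, or $|u|=|v|$ and $u>_{lex}v$. For a non-associative word $(u)$ on $X$ let $u$ be its underlying associative word. For $\bullet\in\{lex, deg\text{-}lex\}$ put $(u)\succ_{\bullet}(v)$ if $u>_{\bullet}v$, or if $u=v$, $(u)=((u_1)(u_2))$, $(v)=((v_1)(v_2))$ and either $(u_1)\succ_{\bullet}(v_1)$, or $(u_1)=(v_1)$ and $(u_2)\succ_{\bullet}(v_2)$. Normal words are defined inductively: letters are normal, and $((u)(v))$ is normal if $(u),(v)$ are normal and $(u)\succ_{lex}(v)$; $N(X)$ is the set of normal words. The free anti-commutative algebra $AC(X)$ is the $k$-vector space with basis $N(X)$ and the bilinear product given on $[u],[v]\in N(X)$ by $[u][v]=[[u][v]]$ if $[u]\succ_{lex}[v]$, $[u][v]=-[[v][u]]$ if $[v]\succ_{lex}[u]$, and $[u][u]=0$. Non-associative Lyndon–Shirshov words (NLSWs) are defined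 inductively: letters are NLSWs, and $((v)(w))$ is an NLSW if $(v),(w)$ are NLSWs, $v>_{lex}w$ and, in case $(v)=((v_1)(v_2))$, $v_2\le_{lex}w$. Leading words $\bar f$ of non-zero $f\in AC(X)$ are taken with respect to $\succ_{deg\text{-}lex}$; $f$ is monic if the coefficient of $\bar f$ is $1$. For $S\subseteq AC(X)$ and $s\in S$ with $s\neq 0$, an $s$-word $(asb)$ is obtained from a non-associative word with one hole by putting $s$ in the hole and evaluating in $AC(X)$; it is a normal $S$-word, written $[asb]$, if the word $(a\bar sb)$ obtained by putting $\bar s$ in the hole is normal. $Id(S)$ is the two-sided ideal of the $k$-algebra $AC(X)$ generated by $S$, and $Irr(S)$ is the set of those normal words that are not of the form $[a\bar sb]$ with $[asb]$ a normal $S$-word. A set $S$ of monic elements is a Gröbner–Shirshov basis if for all $f,g\in S$ and every normal $g$-word $[agb]$ with $[a\bar gb]=\bar f$, the composition $f-[agb]$ is a $k$-linear combination of normal $S$-words $[a_is_ib_i]$ with $[a_i\bar s_ib_i]\prec_{deg\text{-}lex}\bar f$. Let $$S=\{([u][v])[w]-([u][w])[v]-[u]([v][w]) : [u],[v],[w]\in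 N(X),\ [u]\succ_{lex}[v]\succ_{lex}[w]\},$$ $$S_0=\{(\hat u\hat v)\hat w-(\hat u\hat w)\hat v-\hat u(\hat v\hat w) : \hat u,\hat v,\hat w \text{ NLSWs},\ \hat u\succ_{lex}\hat v\succ_{lex}\hat w\}.$$ **Theorem.** $S_0$ is a Gröbner–Shirshov basis in $AC(X)$ (and $S_0\neq\emptyset$ if $X$ has at least two elements). Moreover $Id(S_0)=Id(S)$, $Irr(S_0)$ is exactly the set of all NLSWs, and the NLSWs, read as Lie monomials, form a $k$-linear basis of the free Lie algebra $Lie(X)$ over $k$: their values are linearly independent and span. -/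

import Mathlib

namespace LyndonShirshov

/-! ### Words

Non-associative words on `X` are elements of `FreeMagma X`; associative words are lists. -/

section Words

variable {X : Type*}

/-- The associative word underlying a non-associative word (forget the brackets). -/
def word : FreeMagma X → List X
  | .of x => [x]
  | .mul u v => word u ++ word v

variable [LinearOrder X]

/-- `u >_lex v` on associative words: either `u` is a proper prefix of `v`
(so `u >_lex uv` for non-empty `v`), or at the first place where the two words differ
the letter of `u` is the larger one. -/
def WordLexGT (u v : List X) : Prop := List.Lex (fun x y : X => y < x) u v

/-- `u >_deg-lex v` on associative words: compare lengths first, then lexicographically. -/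
def WordDegLexGT (u v : List X) : Prop :=
  v.length < u.length ∨ (u.length = v.length ∧ WordLexGT u v)

/-- `(u) ≻_lex (v)` on non-associative words. -/
def LexGT : FreeMagma X → FreeMagma X → Prop
  | .of x, v => WordLexGT [x] (word v)
  | .mul u₁ u₂, .of y => WordLexGT (word u₁ ++ word u₂) [y]
  | .mul u₁ u₂, .mul v₁ v₂ =>
      WordLexGT (word u₁ ++ word u₂) (word v₁ ++ word v₂) ∨
      (word u₁ ++ word u₂ = word v₁ ++ word v₂ ∧
        (LexGT u₁ v₁ ∨ (u₁ = v₁ ∧ LexGT u₂ v₂)))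

/-- `(u) ≻_deg-lex (v)` on non-associative words. -/
def DegLexGT : FreeMagma X → FreeMagma X → Prop
  | .of x, v => WordDegLexGT [x] (word v)
  | .mul u₁ u₂, .of y => WordDegLexGT (word u₁ ++ word u₂) [y]
  | .mul u₁ u₂, .mul v₁ v₂ =>
      WordDegLexGT (word u₁ ++ word u₂) (word v₁ ++ word v₂) ∨
      (word u₁ ++ word u₂ = word v₁ ++ word v₂ ∧
        (DegLexGT u₁ v₁ ∨ (u₁ = v₁ ∧ DegLexGT u₂ v₂)))

/-- Normal non-associative words. -/
def IsNormal : FreeMagma X → Prop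
  | .of _ => True
  | .mul u v => IsNormal u ∧ IsNormal v ∧ LexGT u v

/-- Non-associative Lyndon–Shirshov words. -/
def IsNLSW : FreeMagma X → Prop
  | .of _ => True
  | .mul v w => IsNLSW v ∧ IsNLSW w ∧ WordLexGT (word v) (word w) ∧
      ∀ v₁ v₂ : FreeMagma X, v = .mul v₁ v₂ →
        word v₂ = word w ∨ WordLexGT (word w) (word v₂)

end Words

/-- The set `N(X)` of normal words. -/
abbrev NormalWord (X : Type*) [LinearOrder X] : Type _ := {u : FreeMagma X // IsNormal u}

/-! ### The free anti-commutative algebra -/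

/-- The vector space with basis `N(X)`, underlying the free anti-commutative algebra `AC(X)`;
the multiplication is `AC.mul` below (not the pointwise product of finitely supported
functions). -/
abbrev AC (k X : Type*) [Field k] [LinearOrder X] : Type _ := NormalWord X →₀ k

noncomputable section

variable {k X : Type*} [Field k] [LinearOrder X]

/-- A normal word as a basis element of `AC(X)`. -/
def AC.mono (u : NormalWord X) : AC k X := Finsupp.single u 1

open Classical in
/-- The product of two normal words in `AC(X)`: `[[u][v]]` if `[u] ≻_lex [v]`,
`-[[v][u]]` if `[v] ≻_lex [u]`, and `0` otherwise, that is if `[u] = [v]`. -/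
def AC.monoMul (u v : NormalWord X) : AC k X :=
  if h : LexGT u.1 v.1 then AC.mono ⟨.mul u.1 v.1, u.2, v.2, h⟩
  else if h : LexGT v.1 u.1 then - AC.mono ⟨.mul v.1 u.1, v.2, u.2, h⟩
  else 0

/-- The multiplication of `AC(X)`, the bilinear extension of `AC.monoMul`. -/
def AC.mul : AC k X →ₗ[k] AC k X →ₗ[k] AC k X :=
  Finsupp.linearCombination k fun u =>
    Finsupp.linearCombination k fun v => AC.monoMul u v

/-- The value in `AC(X)` of a non-associative word. -/
def AC.ofWord : FreeMagma X → AC k X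
  | .of x => AC.mono ⟨.of x, trivial⟩
  | .mul u v => AC.mul (AC.ofWord u) (AC.ofWord v)

/-- The Jacobian `(fg)h - (fh)g - f(gh)` in `AC(X)`. -/
def AC.jacobian (f g h : AC k X) : AC k X :=
  AC.mul (AC.mul f g) h - AC.mul (AC.mul f h) g - AC.mul f (AC.mul g h)

/-- The (two-sided) ideal of the algebra `AC(X)` generated by `S`: the smallest subspace
containing `S` and closed under multiplication by elements of `AC(X)` on either side. -/
def AC.Id (S : Set (AC k X)) : Submodule k (AC k X) :=
  sInf {I | S ⊆ I ∧ ∀ f ∈ I, ∀ g : AC k X, AC.mul f g ∈ I ∧ AC.mul g f ∈ I}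

/-! ### Gröbner–Shirshov bases in `AC(X)` -/

/-- `w` is the leading word of `f` with respect to `≻_deg-lex`. -/
def IsLead (f : AC k X) (w : NormalWord X) : Prop :=
  w ∈ f.support ∧ ∀ v ∈ f.support, v ≠ w → DegLexGT w.1 v.1

/-- `f` is monic: the coefficient of its leading word is `1`. -/
def IsMonic (f : AC k X) : Prop := ∃ w, IsLead f w ∧ f w = 1

/-- Non-associative words with exactly one hole. -/
inductive Ctx (X : Type*) : Type _
  | hole : Ctx X
  | mulRight (c : Ctx X) (v : FreeMagma X) : Ctx X
  | mulLeft (v : FreeMagma X) (c : Ctx X) : Ctx X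

/-- Put the word `u` in the hole. -/
def Ctx.fill : Ctx X → FreeMagma X → FreeMagma X
  | .hole, u => u
  | .mulRight c v, u => .mul (c.fill u) v
  | .mulLeft v c, u => .mul v (c.fill u)

/-- Put the polynomial `s` in the hole and multiply out in `AC(X)`; these are the `s`-words. -/
def Ctx.eval : Ctx X → AC k X → AC k X
  | .hole, s => s
  | .mulRight c v, s => AC.mul (c.eval s) (AC.ofWord v)
  | .mulLeft v c, s => AC.mul (AC.ofWord v) (c.eval s)

/-- `p` is a normal `S`-word `[u]_s` (`s ∈ S`), where `w` is the word `[u]_{[s̄]}` obtained by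
replacing `s` by its leading word `s̄` (`w` is required to be normal, through its type). -/
def IsNormalSWord (S : Set (AC k X)) (p : AC k X) (w : NormalWord X) : Prop :=
  ∃ s ∈ S, ∃ l : NormalWord X, IsLead s l ∧
    ∃ c : Ctx X, c.fill l.1 = w.1 ∧ p = c.eval s

/-- `h` is trivial modulo `(S, w)`: a linear combination of normal `S`-words whose words
`[u]_{[s̄]}` are all smaller than `w`. -/
def TrivialMod (S : Set (AC k X)) (w : NormalWord X) (h : AC k X) : Prop :=
  h ∈ Submodule.span k {p | ∃ v : NormalWord X, IsNormalSWord S p v ∧ DegLexGT w.1 v.1}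

/-- Gröbner–Shirshov bases: sets of monic polynomials all of whose compositions of inclusion
`(f, g)_w = f - [agb]`, where `w = f̄ = [aḡb]`, are trivial modulo `(S, w)`. -/
def IsGSB (S : Set (AC k X)) : Prop :=
  (∀ s ∈ S, IsMonic s) ∧
  ∀ f ∈ S, ∀ g ∈ S, ∀ (w : NormalWord X) (p : AC k X),
    IsLead f w → IsNormalSWord {g} p w → TrivialMod S w (f - p)

/-- `Irr(S)`: the normal words that are not of the form `[a s̄ b]` for a normal `S`-word. -/
def Irr (S : Set (AC k X)) : Set (NormalWord X) :=
  {u | ¬ ∃ p : AC k X, IsNormalSWord S p u}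

variable (k X)

/-- `S`: all Jacobians on normal words `[u] ≻_lex [v] ≻_lex [w]`. -/
def jacobians : Set (AC k X) :=
  {f | ∃ u v w : NormalWord X, LexGT u.1 v.1 ∧ LexGT v.1 w.1 ∧
    f = AC.jacobian (AC.mono u) (AC.mono v) (AC.mono w)}

/-- `S₀`: all Jacobians on non-associative Lyndon–Shirshov words `û ≻_lex v̂ ≻_lex ŵ`. -/
def jacobiansNLSW : Set (AC k X) :=
  {f | ∃ u v w : FreeMagma X, IsNLSW u ∧ IsNLSW v ∧ IsNLSW w ∧ LexGT u v ∧ LexGT v w ∧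
    f = AC.jacobian (AC.ofWord u) (AC.ofWord v) (AC.ofWord w)}

variable {X}

/-- The value in the free Lie algebra of a non-associative word, read as a Lie monomial. -/
def lieEval : FreeMagma X → FreeLieAlgebra k X
  | .of x => FreeLieAlgebra.of k x
  | .mul u v => ⁅lieEval u, lieEval v⁆

end

end LyndonShirshov

/-! The Gröbner–Shirshov property is not checked by reducing compositions by hand. It follows from
two facts: normal words reduce modulo $S_0$ to NLSWs, and NLSWs are linearly independent in
$Lie(X)$.

Reduction: for NLSWs $u\succ v\succ w$ the leading word of the Jacobian is $(uv)w$
(`jacobian_sub_mem`). A normal word that is not an NLSW contains such a subword, and multiplying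
outwards preserves the leading word (`AC.mul_left_sub_mem`, `AC.mul_right_sub_mem`), so it is the
leading word of a normal $S_0$-word (`exists_isNormalSWord`). As $\succ_{deg\text{-}lex}$ is
well-founded, $AC(X)$ is $Id(S_0)$ plus the span of the NLSWs (`id_sup_nlswSpan`).

Independence: in the free associative algebra the value of an NLSW is its underlying word plus
lexicographically smaller words of the same length, and an NLSW is determined by its word
(`IsNLSW.eq_of_word_eq`). Hence `linearIndependent_lieEval`.

The map $AC(X)\to Lie(X)$ kills $Id(S_0)$ and is surjective, so the NLSWs form a basis. A
composition lies in $Id(S_0)$ and below its word $W$. Reducing it uses only normal $S_0$-words below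
$W$ and leaves a combination of NLSWs that vanishes in $Lie(X)$, hence is zero
(`trivialMod_of_mem_below`). The ideals agree because the Jacobian is trilinear and alternating, so
its arguments can be reduced to NLSWs one at a time. -/

namespace LyndonShirshov

/-! ### Orders on associative words, and Lyndon words -/

section WordOrder

variable {X : Type*} [LinearOrder X]

/-- `u` and `v` differ at some place, and at the first such place the letter of `u` is larger. -/
def DiffGT (u v : List X) : Prop :=
  ∃ (p : List X) (a b : X) (u' v' : List X), u = p ++ a :: u' ∧ v = p ++ b :: v' ∧ b < a

theorem wordLexGT_iff {u v : List X} :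
    WordLexGT u v ↔ (∃ z, z ≠ [] ∧ v = u ++ z) ∨ DiffGT u v := by
  unfold WordLexGT
  constructor
  · intro h
    induction h with
    | nil => exact Or.inl ⟨_, by simp, rfl⟩
    | @cons a l₁ l₂ _ ih =>
      rcases ih with ⟨z, hz, rfl⟩ | ⟨p, b, c, u', v', rfl, rfl, hcb⟩
      · exact Or.inl ⟨z, hz, rfl⟩
      · exact Or.inr ⟨a :: p, b, c, u', v', rfl, rfl, hcb⟩
    | @rel a l₁ b l₂ h => exact Or.inr ⟨[], a, b, l₁, l₂, rfl, rfl, h⟩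
  · rintro (⟨z, hz, rfl⟩ | ⟨p, a, b, u', v', rfl, rfl, hba⟩)
    · induction u with
      | nil =>
        cases z with
        | nil => exact absurd rfl hz
        | cons => exact List.Lex.nil
      | cons a u ih => exact List.Lex.cons ih
    · induction p with
      | nil => exact List.Lex.rel hba
      | cons c p ih => exact List.Lex.cons ih

theorem DiffGT.wordLexGT {u v : List X} (h : DiffGT u v) : WordLexGT u v :=
  wordLexGT_iff.2 (Or.inr h)

theorem DiffGT.append {u v : List X} (h : DiffGT u v) (a b : List X) :
    DiffGT (u ++ a) (v ++ b) := by
  obtain ⟨p, x, y, u', v', rfl, rfl, hxy⟩ := h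
  exact ⟨p, x, y, u' ++ a, v' ++ b, by simp, by simp, hxy⟩

theorem DiffGT.wordLexGT_append {u v : List X} (h : DiffGT u v) (a b : List X) :
    WordLexGT (u ++ a) (v ++ b) :=
  (h.append a b).wordLexGT

theorem wordLexGT_append_right (u : List X) {z : List X} (hz : z ≠ []) :
    WordLexGT u (u ++ z) :=
  wordLexGT_iff.2 (Or.inl ⟨z, hz, rfl⟩)

theorem wordLexGT_append_left (c : List X) {u v : List X} (h : WordLexGT u v) :
    WordLexGT (c ++ u) (c ++ v) := by
  induction c with
  | nil => exact h
  | cons a c ih => exact List.Lex.cons ih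

theorem wordLexGT_irrefl (u : List X) : ¬ WordLexGT u u := by
  intro h
  induction u with
  | nil => cases h
  | cons a u ih =>
    cases h with
    | cons h => exact ih h
    | rel h => exact lt_irrefl _ h

theorem WordLexGT.ne {u v : List X} (h : WordLexGT u v) : u ≠ v := by
  rintro rfl
  exact wordLexGT_irrefl _ h

theorem WordLexGT.trans {u v w : List X} (h₁ : WordLexGT u v) (h₂ : WordLexGT v w) :
    WordLexGT u w := by
  unfold WordLexGT at *
  induction h₁ generalizing w with
  | nil => cases h₂ <;> exact List.Lex.nil
  | cons _ ih =>
    cases h₂ with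
    | cons h => exact List.Lex.cons (ih h)
    | rel h => exact List.Lex.rel h
  | rel h =>
    cases h₂ with
    | cons _ => exact List.Lex.rel h
    | rel h' => exact List.Lex.rel (h'.trans h)

theorem WordLexGT.asymm {u v : List X} (h₁ : WordLexGT u v) : ¬ WordLexGT v u :=
  fun h₂ => wordLexGT_irrefl u (h₁.trans h₂)

theorem wordLexGT_trichotomy (u v : List X) : WordLexGT u v ∨ u = v ∨ WordLexGT v u := by
  induction u generalizing v with
  | nil =>
    cases v with
    | nil => exact Or.inr (Or.inl rfl)
    | cons => exact Or.inl List.Lex.nil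
  | cons a u ih =>
    cases v with
    | nil => exact Or.inr (Or.inr List.Lex.nil)
    | cons b v =>
      rcases lt_trichotomy a b with h | rfl | h
      · exact Or.inr (Or.inr (List.Lex.rel h))
      · rcases ih v with h | rfl | h
        · exact Or.inl (List.Lex.cons h)
        · exact Or.inr (Or.inl rfl)
        · exact Or.inr (Or.inr (List.Lex.cons h))
      · exact Or.inl (List.Lex.rel h)

/-- The length bound rules out the prefix clause. This matters because only a comparison decided at
a letter survives appending arbitrary words on the right. -/
theorem WordLexGT.diffGT {u v : List X} (h : WordLexGT u v) (hl : v.length ≤ u.length) :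
    DiffGT u v := by
  rcases wordLexGT_iff.1 h with ⟨z, hz, rfl⟩ | h
  · have := List.length_pos_iff.2 hz
    simp at hl
    exact absurd hl hz
  · exact h

theorem WordDegLexGT.trans {u v w : List X} (h₁ : WordDegLexGT u v) (h₂ : WordDegLexGT v w) :
    WordDegLexGT u w := by
  rcases h₁ with h₁ | ⟨e₁, h₁⟩ <;> rcases h₂ with h₂ | ⟨e₂, h₂⟩
  · exact Or.inl (by omega)
  · exact Or.inl (by omega)
  · exact Or.inl (by omega)
  · exact Or.inr ⟨by omega, h₁.trans h₂⟩

/-- At equal lengths the prefix clause is void, so the order is the shortlex order of a well-ordered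
alphabet. -/
theorem wordDegLexGT_wellFounded [WellFoundedLT X] :
    WellFounded fun u v : List X => WordDegLexGT v u := by
  refine Subrelation.wf (r := List.Shortlex (· < ·)) ?_
    (List.Shortlex.wf (IsWellFounded.wf (r := fun x y : X => x < y)))
  rintro u v (h | ⟨e, h⟩)
  · exact List.Shortlex.of_length_lt h
  · refine List.Shortlex.of_lex e.symm ?_
    obtain ⟨p, a, b, u', v', rfl, rfl, hba⟩ := h.diffGT e.ge
    clear e h
    induction p with
    | nil => exact List.Lex.rel hba
    | cons c p ih => exact List.Lex.cons ih

/-- Lyndon words with respect to the order in which `WordLexGT u v` means that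
`u` precedes `v`. -/
def IsLyndon (w : List X) : Prop :=
  ∀ p s : List X, w = p ++ s → p ≠ [] → s ≠ [] → WordLexGT w s

/-- The only delicate case is $v=uz$: then $v>z$ since $v$ is Lyndon, and prefixing $u$ gives
$uv>uz=v$. -/
theorem IsLyndon.append_wordLexGT {u v : List X} (hv : IsLyndon v) (hu0 : u ≠ [])
    (h : WordLexGT u v) : WordLexGT (u ++ v) v := by
  rcases wordLexGT_iff.1 h with ⟨z, hz, e⟩ | h
  · conv_rhs => rw [e]
    exact wordLexGT_append_left u (hv u z e hu0 hz)
  · simpa using h.wordLexGT_append v []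

theorem IsLyndon.append {u v : List X} (hu : IsLyndon u) (hv : IsLyndon v) (hu0 : u ≠ [])
    (h : WordLexGT u v) : IsLyndon (u ++ v) := by
  intro p s e hp hs
  have huv := hv.append_wordLexGT hu0 h
  rcases List.append_eq_append_iff.1 e with ⟨a, rfl, rfl⟩ | ⟨a, rfl, rfl⟩
  · rcases eq_or_ne a [] with rfl | ha
    · exact huv
    · exact huv.trans (hv a s rfl ha hs)
  · rcases eq_or_ne a [] with rfl | ha
    · exact huv
    · exact ((hu p a rfl hp ha).diffGT (by simp)).wordLexGT_append v v

theorem IsLyndon.append_wordLexGT_append {u v : List X} (hv : IsLyndon v) (hu0 : u ≠ [])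
    (h : WordLexGT u v) : WordLexGT (u ++ v) (v ++ u) :=
  (hv.append_wordLexGT hu0 h).trans (wordLexGT_append_right v hu0)

end WordOrder

/-! ### Uniqueness of the Lyndon–Shirshov bracketing -/

section NLSW

variable {X : Type*}

theorem word_ne_nil (u : FreeMagma X) : word u ≠ [] := by
  induction u using FreeMagma.rec with
  | of x => simp [word]
  | mul u v hu _ => simp [word, hu]

theorem word_length_mul (u v : FreeMagma X) :
    (word (.mul u v)).length = (word u).length + (word v).length :=
  List.length_append

theorem word_length_pos (u : FreeMagma X) : 0 < (word u).length :=
  List.length_pos_iff.2 (word_ne_nil u)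

theorem word_length_lt_left (u v : FreeMagma X) :
    (word u).length < (word (.mul u v)).length := by
  have := word_length_pos v
  rw [word_length_mul]
  omega

theorem word_length_lt_right (u v : FreeMagma X) :
    (word v).length < (word (.mul u v)).length := by
  have := word_length_pos u
  rw [word_length_mul]
  omega

theorem eq_of_word_eq_singleton {u : FreeMagma X} {x : X} (h : word u = [x]) :
    u = .of x := by
  cases u with
  | of y => exact congrArg FreeMagma.of (by simpa [word] using h)
  | mul u v =>
    have := congrArg List.length h
    have h₁ := word_length_pos u
    have h₂ := word_length_pos v
    simp [word] at this
    omega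

variable [LinearOrder X]

theorem IsNLSW.isLyndon {u : FreeMagma X} (h : IsNLSW u) : IsLyndon (word u) := by
  induction u using FreeMagma.rec with
  | of x =>
    intro p s e hp hs
    have := congrArg List.length e
    have h₁ := List.length_pos_iff.2 hp
    have h₂ := List.length_pos_iff.2 hs
    simp [word] at this
    omega
  | mul v w hv hw => exact (hv h.1).append (hw h.2.1) (word_ne_nil v) h.2.2.1

/-- The right factor of an NLSW is the first among its proper suffixes. -/
theorem IsNLSW.right_le_suffix {v w : FreeMagma X} (h : IsNLSW (.mul v w)) {p s : List X}
    (e : word v ++ word w = p ++ s) (hp : p ≠ []) (hs : s ≠ []) :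
    word w = s ∨ WordLexGT (word w) s := by
  induction v using FreeMagma.rec generalizing w p s with
  | of x =>
    rcases List.append_eq_append_iff.1 e with ⟨a, rfl, ha⟩ | ⟨a, ha, rfl⟩
    · rcases eq_or_ne a [] with rfl | ha0
      · exact Or.inl ha
      · exact Or.inr (h.2.1.isLyndon a s ha ha0 hs)
    · rcases eq_or_ne a [] with rfl | ha0
      · exact Or.inl rfl
      · have := congrArg List.length ha
        have h₁ := List.length_pos_iff.2 hp
        have h₂ := List.length_pos_iff.2 ha0
        simp [word] at this
        omega
  | mul v₁ v₂ ih₁ ih₂ =>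
    rcases List.append_eq_append_iff.1 e with ⟨a, rfl, ha⟩ | ⟨a, ha, rfl⟩
    · rcases eq_or_ne a [] with rfl | ha0
      · exact Or.inl ha
      · exact Or.inr (h.2.1.isLyndon a s ha ha0 hs)
    · rcases eq_or_ne a [] with rfl | ha0
      · exact Or.inl rfl
      · right
        -- Here $s=aw$ with $a$ a proper suffix of $v_1v_2$, and the chain is $w\ge v_2\ge a>aw$.
        have key : WordLexGT a (a ++ word w) := wordLexGT_append_right a (word_ne_nil w)
        rcases ih₁ h.1 ha hp ha0 with h₁ | h₁ <;> rcases h.2.2.2 v₁ v₂ rfl with h₂ | h₂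
        · rwa [← h₁, h₂] at key ⊢
        · exact (h₁ ▸ h₂).trans key
        · exact (h₂ ▸ h₁).trans key
        · exact (h₂.trans h₁).trans key

/-- If $v_1=v_2z$ were longer, then $w_2=zw_1$ is Lyndon, so $zw_1>w_1$. But $z$ is a proper suffix
of $v_1=ab$, so $w_1\ge b\ge z>zw_1$, a contradiction. -/
theorem IsNLSW.length_le_right {v₁ w₁ v₂ w₂ : FreeMagma X} (h₁ : IsNLSW (.mul v₁ w₁))
    (h₂ : IsNLSW (.mul v₂ w₂)) (e : word v₁ ++ word w₁ = word v₂ ++ word w₂) :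
    (word v₁).length ≤ (word v₂).length := by
  by_contra! hlt
  obtain ⟨z, hz⟩ : ∃ z, word v₁ = word v₂ ++ z :=
    (List.prefix_of_prefix_length_le (List.prefix_append (word v₂) (word w₂))
      (e ▸ List.prefix_append (word v₁) (word w₁)) hlt.le).imp fun _ h => h.symm
  have hz0 : z ≠ [] := by
    rintro rfl
    simp [hz] at hlt
  have hw : word w₂ = z ++ word w₁ := by
    rw [hz, List.append_assoc] at e
    exact (List.append_cancel_left e).symm
  have h₃ : WordLexGT (z ++ word w₁) (word w₁) := by
    have := h₂.2.1.isLyndon z (word w₁) hw hz0 (word_ne_nil _)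
    rwa [hw] at this
  have key : WordLexGT z (z ++ word w₁) := wordLexGT_append_right z (word_ne_nil w₁)
  cases v₁ with
  | of x =>
    have := congrArg List.length hz
    have := word_length_pos v₂
    have := List.length_pos_iff.2 hz0
    simp [word] at *
    omega
  | mul a b =>
    have h₄ := h₁.1.right_le_suffix hz (word_ne_nil v₂) hz0
    have h₅ := h₁.2.2.2 a b rfl
    have h₆ : word w₁ = z ∨ WordLexGT (word w₁) z := by
      rcases h₄ with h₄ | h₄ <;> rcases h₅ with h₅ | h₅
      · exact Or.inl (h₅ ▸ h₄)
      · exact Or.inr (h₄ ▸ h₅)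
      · exact Or.inr (h₅ ▸ h₄)
      · exact Or.inr (h₅.trans h₄)
    rcases h₆ with h₆ | h₆
    · exact (h₆ ▸ key).asymm (h₆ ▸ h₃)
    · exact (key.trans h₃).asymm h₆

theorem IsNLSW.eq_of_word_eq {u v : FreeMagma X} (hu : IsNLSW u) (hv : IsNLSW v)
    (e : word u = word v) : u = v := by
  induction u using FreeMagma.rec generalizing v with
  | of x => exact (eq_of_word_eq_singleton e.symm).symm
  | mul a b iha ihb =>
    cases v with
    | of x => exact eq_of_word_eq_singleton e
    | mul c d =>
      obtain ⟨h₁, h₂⟩ := List.append_inj e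
        (le_antisymm (hu.length_le_right hv e) (hv.length_le_right hu e.symm))
      rw [iha hu.1 hv.1 h₁, ihb hu.2.1 hv.2.1 h₂]

end NLSW


/-! ### Orders on non-associative words -/

section MagmaOrder

variable {X : Type*} [LinearOrder X]

theorem lexGT_of_wordLexGT {u v : FreeMagma X} (h : WordLexGT (word u) (word v)) :
    LexGT u v := by
  cases u with
  | of x => exact h
  | mul a b =>
    cases v with
    | of y => exact h
    | mul c d => exact Or.inl h

theorem degLexGT_of_wordDegLexGT {u v : FreeMagma X}
    (h : WordDegLexGT (word u) (word v)) : DegLexGT u v := by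
  cases u with
  | of x => exact h
  | mul a b =>
    cases v with
    | of y => exact h
    | mul c d => exact Or.inl h

theorem degLexGT_of_length {u v : FreeMagma X} (h : (word v).length < (word u).length) :
    DegLexGT u v :=
  degLexGT_of_wordDegLexGT (Or.inl h)

theorem degLexGT_mul_left {a b c d : FreeMagma X}
    (e : word a ++ word b = word c ++ word d) (h : DegLexGT a c) :
    DegLexGT (.mul a b) (.mul c d) :=
  Or.inr ⟨e, Or.inl h⟩

theorem degLexGT_mul_right {a b d : FreeMagma X} (e : word b = word d) (h : DegLexGT b d) :
    DegLexGT (.mul a b) (.mul a d) :=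
  Or.inr ⟨by rw [e], Or.inr ⟨rfl, h⟩⟩

theorem LexGT.word_eq_or {u v : FreeMagma X} (h : LexGT u v) :
    word u = word v ∨ WordLexGT (word u) (word v) := by
  cases u with
  | of x => exact Or.inr h
  | mul a b =>
    cases v with
    | of y => exact Or.inr h
    | mul c d => exact h.symm.imp_left And.left

theorem DegLexGT.cases {u v : FreeMagma X} (h : DegLexGT u v) :
    (word v).length < (word u).length ∨
      ((word u).length = (word v).length ∧ DiffGT (word u) (word v)) ∨ word u = word v := by
  have : WordDegLexGT (word u) (word v) ∨ word u = word v := by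
    cases u with
    | of x => exact Or.inl h
    | mul a b =>
      cases v with
      | of y => exact Or.inl h
      | mul c d => exact h.imp_right And.left
  rcases this with (h | ⟨e, h⟩) | h
  · exact Or.inl h
  · exact Or.inr (Or.inl ⟨e, h.diffGT e.ge⟩)
  · exact Or.inr (Or.inr h)

theorem lexGT_irrefl (u : FreeMagma X) : ¬ LexGT u u := by
  induction u using FreeMagma.rec with
  | of x => exact wordLexGT_irrefl _
  | mul a b iha ihb =>
    rintro (h | ⟨-, h | ⟨-, h⟩⟩)
    · exact wordLexGT_irrefl _ h
    · exact iha h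
    · exact ihb h

theorem LexGT.asymm {u v : FreeMagma X} (h : LexGT u v) : ¬ LexGT v u := by
  induction u using FreeMagma.rec generalizing v with
  | of x =>
    intro h'
    rcases h'.word_eq_or with e | h'
    · obtain rfl := eq_of_word_eq_singleton e
      exact lexGT_irrefl _ h
    · exact WordLexGT.asymm h h'
  | mul a b iha ihb =>
    cases v with
    | of y => exact WordLexGT.asymm h
    | mul c d =>
      rcases h with h | ⟨e, h⟩
      · rintro (h' | ⟨e, -⟩)
        · exact h.asymm h'
        · exact wordLexGT_irrefl _ (e ▸ h)
      · rintro (h' | ⟨-, h'⟩)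
        · exact wordLexGT_irrefl _ (e ▸ h')
        · rcases h with h | ⟨rfl, h⟩ <;> rcases h' with h' | ⟨e', h'⟩
          · exact iha h h'
          · exact lexGT_irrefl _ (e' ▸ h)
          · exact lexGT_irrefl _ h'
          · exact ihb h h'

theorem lexGT_trichotomy (u v : FreeMagma X) : LexGT u v ∨ u = v ∨ LexGT v u := by
  induction u using FreeMagma.rec generalizing v with
  | of x =>
    rcases wordLexGT_trichotomy (word (.of x)) (word v) with h | h | h
    · exact Or.inl h
    · exact Or.inr (Or.inl (eq_of_word_eq_singleton h.symm).symm)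
    · exact Or.inr (Or.inr (lexGT_of_wordLexGT h))
  | mul a b iha ihb =>
    rcases wordLexGT_trichotomy (word (.mul a b)) (word v) with h | h | h
    · exact Or.inl (lexGT_of_wordLexGT h)
    · cases v with
      | of y => exact Or.inr (Or.inl (eq_of_word_eq_singleton h))
      | mul c d =>
        rcases iha c with h' | rfl | h'
        · exact Or.inl (Or.inr ⟨h, Or.inl h'⟩)
        · rcases ihb d with h' | rfl | h'
          · exact Or.inl (Or.inr ⟨h, Or.inr ⟨rfl, h'⟩⟩)
          · exact Or.inr (Or.inl rfl)
          · exact Or.inr (Or.inr (Or.inr ⟨h.symm, Or.inr ⟨rfl, h'⟩⟩))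
        · exact Or.inr (Or.inr (Or.inr ⟨h.symm, Or.inl h'⟩))
    · exact Or.inr (Or.inr (lexGT_of_wordLexGT h))

theorem DegLexGT.trans {u v w : FreeMagma X} (h₁ : DegLexGT u v) (h₂ : DegLexGT v w) :
    DegLexGT u w := by
  induction u using FreeMagma.rec generalizing v w with
  | of x =>
    rcases h₂.cases with h | ⟨e, h⟩ | h
    · exact WordDegLexGT.trans h₁ (Or.inl h)
    · exact WordDegLexGT.trans h₁ (Or.inr ⟨e, h.wordLexGT⟩)
    · unfold DegLexGT at h₁ ⊢
      rwa [← h]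
  | mul a b iha ihb =>
    cases v with
    | of y => exact degLexGT_of_wordDegLexGT (WordDegLexGT.trans h₁ h₂)
    | mul c d =>
      cases w with
      | of z =>
        rcases h₁ with h₁ | ⟨e, -⟩
        · exact WordDegLexGT.trans h₁ h₂
        · unfold DegLexGT at h₂ ⊢
          rwa [e]
      | mul p q =>
        rcases h₁ with h₁ | ⟨e₁, h₁⟩ <;> rcases h₂ with h₂ | ⟨e₂, h₂⟩
        · exact Or.inl (h₁.trans h₂)
        · exact Or.inl (e₂ ▸ h₁)
        · exact Or.inl (e₁ ▸ h₂)
        · refine Or.inr ⟨e₁.trans e₂, ?_⟩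
          rcases h₁ with h₁ | ⟨rfl, h₁⟩ <;> rcases h₂ with h₂ | ⟨rfl, h₂⟩
          · exact Or.inl (iha h₁ h₂)
          · exact Or.inl h₁
          · exact Or.inl h₂
          · exact Or.inr ⟨rfl, ihb h₁ h₂⟩

/-- Outer induction on the underlying word; among bracketings of one word the order compares left
factors, then right factors, and both have shorter words, hence are accessible. -/
theorem degLexGT_wellFounded [WellFoundedLT X] :
    WellFounded fun u v : FreeMagma X => DegLexGT v u := by
  have key : ∀ W : List X, ∀ u : FreeMagma X, word u = W →
      Acc (fun u v : FreeMagma X => DegLexGT v u) u := by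
    intro W
    induction W using (wordDegLexGT_wellFounded (X := X)).induction with
    | _ W ih =>
    have small : ∀ u v : FreeMagma X, WordDegLexGT (word u) (word v) → word u = W →
        Acc (fun u v : FreeMagma X => DegLexGT v u) v := by
      rintro u v h rfl
      exact ih _ h v rfl
    intro u hu
    cases u with
    | of x => exact ⟨_, fun v hv => small (.of x) v hv hu⟩
    | mul a b =>
      have ha := small (.mul a b) a (Or.inl (word_length_lt_left a b)) hu
      have hb := small (.mul a b) b (Or.inl (word_length_lt_right a b)) hu
      induction ha generalizing b with
      | intro a _ iha =>
      induction hb with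
      | intro b _ ihb =>
      refine ⟨_, fun v hv => ?_⟩
      cases v with
      | of y => exact small (.mul a b) (.of y) hv hu
      | mul c d =>
        rcases hv with hv | ⟨e, hv | ⟨rfl, hv⟩⟩
        · exact small (.mul a b) (.mul c d) hv hu
        -- The new right factor $d$ is unrelated to $b$; it is accessible because its word is
        -- shorter than $W$.
        · have hcd : word (.mul c d) = W := e.symm.trans hu
          exact iha c hv d hcd
            (small (.mul c d) d (Or.inl (word_length_lt_right c d)) hcd)
        · exact ihb d hv (e.symm.trans hu)
  exact ⟨fun u => key _ u rfl⟩

theorem DegLexGT.asymm [WellFoundedLT X] {u v : FreeMagma X} (h : DegLexGT u v) :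
    ¬ DegLexGT v u :=
  fun h' => degLexGT_wellFounded.asymmetric _ _ h h'

/-- Among non-associative words with the same underlying word, the two orders are opposite. -/
theorem LexGT.degLexGT_of_word_eq {u v : FreeMagma X} (h : LexGT u v)
    (e : word u = word v) : DegLexGT v u := by
  induction u using FreeMagma.rec generalizing v with
  | of x => exact absurd e (WordLexGT.ne h)
  | mul a b iha ihb =>
    cases v with
    | of y => exact absurd e (WordLexGT.ne h)
    | mul c d =>
      rcases h with h | ⟨-, h | ⟨rfl, h⟩⟩
      · exact absurd e h.ne
      · refine degLexGT_mul_left e.symm ?_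
        rcases h.word_eq_or with e' | h'
        · exact iha h e'
        -- Both $a$ and $c$ are prefixes of the same word, so the lex-larger one is the shorter one,
        -- which is deg-lex smaller.
        · rcases lt_or_ge (word a).length (word c).length with hl | hl
          · exact degLexGT_of_length hl
          · exact absurd e ((h'.diffGT hl).wordLexGT_append (word b) (word d)).ne
      · have e' : word b = word d := List.append_cancel_left e
        exact degLexGT_mul_right e'.symm (ihb h e')

theorem IsNLSW.isNormal {u : FreeMagma X} (h : IsNLSW u) : IsNormal u := by
  induction u using FreeMagma.rec with
  | of x => trivial
  | mul v w hv hw => exact ⟨hv h.1, hw h.2.1, lexGT_of_wordLexGT h.2.2.1⟩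

theorem IsNLSW.wordLexGT {u v : FreeMagma X} (hu : IsNLSW u) (hv : IsNLSW v)
    (h : LexGT u v) : WordLexGT (word u) (word v) := by
  rcases h.word_eq_or with e | h'
  · exact absurd (hu.eq_of_word_eq hv e ▸ h) (lexGT_irrefl _)
  · exact h'

/-- Multiplying by a larger word on the left is compatible with the deg-lex order. -/
theorem degLexGT_mul_of_lexGT_left {v l t : FreeMagma X} (hv : LexGT v l)
    (ht : DegLexGT l t) :
    DegLexGT (.mul v l) (.mul v t) ∧ (LexGT t v → DegLexGT (.mul v l) (.mul t v)) := by
  rcases ht.cases with h | ⟨e, h⟩ | h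
  · constructor
    · exact degLexGT_of_length (by simp only [word_length_mul]; omega)
    · exact fun _ => degLexGT_of_length (by simp only [word_length_mul]; omega)
  · constructor
    · exact degLexGT_of_wordDegLexGT
        (Or.inr ⟨by simp only [word_length_mul]; omega, wordLexGT_append_left _ h.wordLexGT⟩)
    · intro htv
      have h' := h.wordLexGT
      rcases htv.word_eq_or with h₁ | h₁ <;> rcases hv.word_eq_or with h₂ | h₂
      · exact absurd (h₁.trans h₂ ▸ h') (wordLexGT_irrefl _)
      · exact absurd (h₁ ▸ h') h₂.asymm
      · exact absurd h' (h₂ ▸ h₁ : WordLexGT (word t) (word l)).asymm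
      · exact absurd h' (h₁.trans h₂).asymm
  · constructor
    · exact degLexGT_mul_right h ht
    · intro htv
      have hvt : word v = word t := by
        rcases htv.word_eq_or with h₁ | h₁
        · exact h₁.symm
        · rcases hv.word_eq_or with h₂ | h₂
          · exact h₂.trans h
          · exact absurd (h ▸ h₂) h₁.asymm
      -- All three words coincide, so $t\succ_{lex}v$ turns into $v\succ_{deg\text{-}lex}t$.
      exact degLexGT_mul_left (by rw [h, hvt]) (htv.degLexGT_of_word_eq hvt.symm)

/-- Multiplying by a smaller Lyndon word on the right is compatible with the deg-lex order. -/
theorem degLexGT_mul_of_lexGT_right [WellFoundedLT X] {v l t : FreeMagma X} (hv : LexGT l v)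
    (hL : IsLyndon (word v)) (ht : DegLexGT l t) :
    DegLexGT (.mul l v) (.mul t v) ∧ (LexGT v t → DegLexGT (.mul l v) (.mul v t)) := by
  rcases ht.cases with h | ⟨e, h⟩ | h
  · constructor
    · exact degLexGT_of_length (by simp only [word_length_mul]; omega)
    · exact fun _ => degLexGT_of_length (by simp only [word_length_mul]; omega)
  · constructor
    · exact degLexGT_of_wordDegLexGT
        (Or.inr ⟨by simp only [word_length_mul]; omega, h.wordLexGT_append _ _⟩)
    · intro _
      refine degLexGT_of_wordDegLexGT (Or.inr ⟨by simp only [word_length_mul]; omega, ?_⟩)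
      change WordLexGT (word l ++ word v) (word v ++ word t)
      rcases hv.word_eq_or with h₂ | h₂
      · rw [← h₂]
        exact wordLexGT_append_left _ h.wordLexGT
      · rcases wordLexGT_iff.1 h₂ with ⟨z, hz, e'⟩ | h₂
        -- This is where the Lyndon property enters: with $v=lz$ the claim $lv>vt$ becomes $lz>zt$,
        -- which holds as $lz>z>zt$.
        · have h₃ := hL (word l) z e' (word_ne_nil l) hz
          rw [e', List.append_assoc] at *
          exact wordLexGT_append_left _ (h₃.trans (wordLexGT_append_right z (word_ne_nil t)))
        · exact h₂.wordLexGT_append _ _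
  · constructor
    · exact degLexGT_mul_left (by rw [h]) ht
    · intro hvt
      have hlv : word l = word v := by
        rcases hv.word_eq_or with h₁ | h₁
        · exact h₁
        · rcases hvt.word_eq_or with h₂ | h₂
          · exact h.trans h₂.symm
          · exact absurd (h ▸ h₁) h₂.asymm
      exact absurd ht ((hvt.degLexGT_of_word_eq (hlv.symm.trans h)).trans
        (hv.degLexGT_of_word_eq hlv)).asymm

end MagmaOrder


/-! ### Leading words of products in the free anti-commutative algebra -/

noncomputable section Algebra

variable {k X : Type*} [Field k] [LinearOrder X]

namespace AC

theorem mul_mono_mono (u v : NormalWord X) : mul (mono u) (mono v : AC k X) = monoMul u v := by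
  simp [mul, mono]

theorem mono_induction {P : AC k X → Prop} (f : AC k X) (hm : ∀ u, P (mono u)) (h0 : P 0)
    (ha : ∀ f g, P f → P g → P (f + g)) (hs : ∀ (c : k) f, P f → P (c • f)) : P f := by
  induction f using Finsupp.induction_linear with
  | zero => exact h0
  | add f g hf hg => exact ha f g hf hg
  | single a b =>
    have := hs b _ (hm a)
    rwa [mono, Finsupp.smul_single, smul_eq_mul, mul_one] at this

theorem monoMul_self (u : NormalWord X) : (monoMul u u : AC k X) = 0 := by
  simp [monoMul, lexGT_irrefl]

theorem mul_mono_of_isNormal {u v : FreeMagma X} (hu : IsNormal u) (hv : IsNormal v)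
    (h : IsNormal (.mul u v)) :
    mul (mono ⟨u, hu⟩) (mono ⟨v, hv⟩ : AC k X) = mono ⟨.mul u v, h⟩ := by
  rw [mul_mono_mono]
  exact dif_pos h.2.2

theorem monoMul_swap (u v : NormalWord X) : (monoMul u v : AC k X) = - monoMul v u := by
  by_cases h : LexGT u.1 v.1
  · simp [monoMul, h, h.asymm]
  · by_cases h' : LexGT v.1 u.1
    · simp [monoMul, h, h']
    · simp [monoMul, h, h']

theorem mul_swap (f g : AC k X) : mul f g = - mul g f := by
  induction f using mono_induction with
  | hm u =>
    induction g using mono_induction with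
    | hm v => rw [mul_mono_mono, mul_mono_mono, monoMul_swap]
    | h0 => simp
    | ha f g hf hg => simp only [map_add, LinearMap.add_apply, hf, hg, neg_add]
    | hs c f hf => simp only [map_smul, LinearMap.smul_apply, hf, smul_neg]
  | h0 => simp
  | ha f g hf hg => simp only [map_add, LinearMap.add_apply, hf, hg, neg_add]
  | hs c f hf => simp only [map_smul, LinearMap.smul_apply, hf, smul_neg]

theorem mul_self (f : AC k X) : mul f f = 0 := by
  induction f using mono_induction with
  | hm u => rw [mul_mono_mono, monoMul_self]
  | h0 => simp
  | ha f g hf hg =>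
    simp only [map_add, LinearMap.add_apply, hf, hg]
    rw [mul_swap f g]
    abel
  | hs c f hf => simp [hf]

theorem ofWord_of_isNormal {u : FreeMagma X} (h : IsNormal u) :
    (ofWord u : AC k X) = mono ⟨u, h⟩ := by
  induction u using FreeMagma.rec with
  | of x => rfl
  | mul a b iha ihb =>
    change mul (ofWord a) (ofWord b) = _
    rw [iha h.1, ihb h.2.1, mul_mono_of_isNormal _ _ h]

/-- The polynomials all of whose words are smaller than `w`. -/
def below (k : Type*) {X : Type*} [Field k] [LinearOrder X] (w : NormalWord X) :
    Submodule k (AC k X) :=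
  Finsupp.supported k k {v : NormalWord X | DegLexGT w.1 v.1}

theorem below_eq_span (w : NormalWord X) :
    below k w = Submodule.span k (mono '' {v : NormalWord X | DegLexGT w.1 v.1}) :=
  Finsupp.supported_eq_span_single k _

theorem mono_mem_below {w v : NormalWord X} (h : DegLexGT w.1 v.1) :
    mono v ∈ below k w := by
  rw [below_eq_span]
  exact Submodule.subset_span ⟨v, h, rfl⟩

theorem below_le {w : NormalWord X} {M : Submodule k (AC k X)}
    (h : ∀ v : NormalWord X, DegLexGT w.1 v.1 → mono v ∈ M) : below k w ≤ M := by
  rw [below_eq_span, Submodule.span_le]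
  rintro _ ⟨v, hv, rfl⟩
  exact h v hv

theorem monoMul_mem_below {w u v : NormalWord X} (h₁ : DegLexGT w.1 (.mul u.1 v.1))
    (h₂ : LexGT v.1 u.1 → DegLexGT w.1 (.mul v.1 u.1)) : monoMul u v ∈ below k w := by
  unfold monoMul
  split_ifs with h h'
  · exact mono_mem_below h₁
  · exact neg_mem (mono_mem_below (h₂ h'))
  · exact zero_mem _

/-- By linearity it suffices to multiply $v$ with each word below $l$; the result stays below $vl$
in whichever order the product arranges its factors. -/
theorem mul_left_sub_mem {f : AC k X} {v l : FreeMagma X} (hv : IsNormal v) (hl : IsNormal l)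
    (h : IsNormal (.mul v l)) (hf : f - mono ⟨l, hl⟩ ∈ below k ⟨l, hl⟩) :
    mul (mono ⟨v, hv⟩) f - mono ⟨.mul v l, h⟩ ∈ below k ⟨.mul v l, h⟩ := by
  rw [← mul_mono_of_isNormal hv hl h, ← map_sub]
  refine (below_le (M := (below k _).comap (mul (mono ⟨v, hv⟩))) fun t ht => ?_) hf
  rw [Submodule.mem_comap, mul_mono_mono]
  have := degLexGT_mul_of_lexGT_left h.2.2 ht
  exact monoMul_mem_below this.1 this.2

variable [WellFoundedLT X]

theorem isLead_of_sub_mem {f : AC k X} {w : NormalWord X} (h : f - mono w ∈ below k w) :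
    IsLead f w ∧ f w = 1 := by
  have hw : f w = 1 := by
    have : (f - mono w : NormalWord X →₀ k) w = 0 := by
      by_contra hne
      have : DegLexGT w.1 w.1 := h (Finsupp.mem_support_iff.2 hne)
      exact this.asymm this
    simpa [mono, sub_eq_zero] using this
  refine ⟨⟨by simp [hw], fun v hv hne => ?_⟩, hw⟩
  refine h (Finsupp.mem_support_iff.2 ?_)
  simpa [mono, Finsupp.single_apply, hne.symm] using hv

theorem isLead_unique {f : AC k X} {v w : NormalWord X} (hv : IsLead f v) (hw : IsLead f w) :
    v = w := by
  by_contra hne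
  exact (hv.2 w hw.1 (Ne.symm hne)).asymm (hw.2 v hv.1 hne)

/-- In contrast to left multiplication, the argument needs the right factor to have a Lyndon word.
-/
theorem mul_right_sub_mem {f : AC k X} {l v : FreeMagma X} (hl : IsNormal l) (hv : IsNormal v)
    (h : IsNormal (.mul l v)) (hL : IsNLSW v) (hf : f - mono ⟨l, hl⟩ ∈ below k ⟨l, hl⟩) :
    mul f (mono ⟨v, hv⟩) - mono ⟨.mul l v, h⟩ ∈ below k ⟨.mul l v, h⟩ := by
  have e : mul f (mono ⟨v, hv⟩) - mono ⟨.mul l v, h⟩ =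
      mul.flip (mono ⟨v, hv⟩) (f - mono ⟨l, hl⟩) := by
    rw [map_sub, LinearMap.flip_apply, LinearMap.flip_apply, mul_mono_of_isNormal hl hv h]
  rw [e]
  refine (below_le (M := (below k _).comap (mul.flip (mono ⟨v, hv⟩))) fun t ht => ?_) hf
  rw [Submodule.mem_comap, LinearMap.flip_apply, mul_mono_mono]
  have := degLexGT_mul_of_lexGT_right h.2.2 hL.isLyndon ht
  exact monoMul_mem_below this.1 this.2

end AC

/-! ### Leading words of Jacobians and reduction to NLSWs -/

theorem isNormal_mul_mul {u v w : FreeMagma X} (hu : IsNLSW u) (hv : IsNLSW v) (hw : IsNLSW w)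
    (huv : LexGT u v) (hvw : LexGT v w) : IsNormal (.mul (.mul u v) w) :=
  ⟨⟨hu.isNormal, hv.isNormal, huv⟩, hw.isNormal, lexGT_of_wordLexGT
    ((hv.isLyndon.append_wordLexGT (word_ne_nil u) (hu.wordLexGT hv huv)).trans
      (hv.wordLexGT hw hvw))⟩

open AC in
/-- The leading word of the Jacobian of the NLSWs `u ≻ v ≻ w` is `(uv)w`. -/
theorem jacobian_sub_mem [WellFoundedLT X] {u v w : FreeMagma X} (hu : IsNLSW u)
    (hv : IsNLSW v) (hw : IsNLSW w) (huv : LexGT u v) (hvw : LexGT v w) :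
    jacobian (ofWord u) (ofWord v) (ofWord w) -
        mono ⟨.mul (.mul u v) w, isNormal_mul_mul hu hv hw huv hvw⟩ ∈
      below k ⟨.mul (.mul u v) w, isNormal_mul_mul hu hv hw huv hvw⟩ := by
  have huv' := hu.wordLexGT hv huv
  have hvw' := hv.wordLexGT hw hvw
  have hN := isNormal_mul_mul hu hv hw huv hvw
  have huwN : IsNormal (.mul u w) :=
    ⟨hu.isNormal, hw.isNormal, lexGT_of_wordLexGT (huv'.trans hvw')⟩
  have hvwN : IsNormal (.mul v w) := ⟨hv.isNormal, hw.isNormal, hvw⟩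
  have huvwN : IsNormal (.mul u (.mul v w)) := ⟨hu.isNormal, hvwN, lexGT_of_wordLexGT
    (huv'.trans (wordLexGT_append_right _ (word_ne_nil w)))⟩
  have e : (jacobian (ofWord u) (ofWord v) (ofWord w) : AC k X) - mono ⟨_, hN⟩ =
      - monoMul ⟨.mul u w, huwN⟩ ⟨v, hv.isNormal⟩ -
        mono ⟨.mul u (.mul v w), huvwN⟩ := by
    rw [jacobian, ofWord_of_isNormal hu.isNormal, ofWord_of_isNormal hv.isNormal,
      ofWord_of_isNormal hw.isNormal, mul_mono_of_isNormal _ _ hN.1,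
      mul_mono_of_isNormal _ _ huwN, mul_mono_of_isNormal _ _ hvwN,
      mul_mono_of_isNormal _ _ hN, mul_mono_of_isNormal _ _ huvwN, mul_mono_mono]
    abel
  rw [e]
  refine sub_mem (neg_mem (monoMul_mem_below ?_ fun _ => ?_)) (mono_mem_below ?_)
  -- Against $(uw)v$ the comparison is $vw>wv$; against $v(uw)$ it is $uv>vu$; against $u(vw)$ the
  -- words agree and the longer left factor wins.
  · refine degLexGT_of_wordDegLexGT (Or.inr ⟨by simp only [word_length_mul]; omega, ?_⟩)
    change WordLexGT ((word u ++ word v) ++ word w) ((word u ++ word w) ++ word v)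
    rw [List.append_assoc, List.append_assoc]
    exact wordLexGT_append_left _ (hw.isLyndon.append_wordLexGT_append (word_ne_nil v) hvw')
  · refine degLexGT_of_wordDegLexGT (Or.inr ⟨by simp only [word_length_mul]; omega, ?_⟩)
    change WordLexGT ((word u ++ word v) ++ word w) (word v ++ (word u ++ word w))
    rw [← List.append_assoc (word v)]
    exact ((hv.isLyndon.append_wordLexGT_append (word_ne_nil u) huv').diffGT
      (by simp [add_comm])).wordLexGT_append _ _
  · exact degLexGT_mul_left (List.append_assoc _ _ _)
      (degLexGT_of_length (word_length_lt_left u v))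

theorem isNLSW_of_fill {c : Ctx X} {u : FreeMagma X} (h : IsNLSW (c.fill u)) :
    IsNLSW u := by
  induction c with
  | hole => exact h
  | mulRight c v ih => exact ih h.1
  | mulLeft v c ih => exact ih h.2.1

theorem not_isNLSW_mul_mul {u v w : FreeMagma X} (hv : IsNLSW v) (hw : IsNLSW w)
    (hvw : LexGT v w) : ¬ IsNLSW (.mul (.mul u v) w) := by
  intro h
  have h' := hv.wordLexGT hw hvw
  rcases h.2.2.2 u v rfl with e | h''
  · exact h'.ne e
  · exact h'.asymm h''

theorem isLead_of_mem_jacobiansNLSW [WellFoundedLT X] {s : AC k X}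
    (hs : s ∈ jacobiansNLSW k X) {l : NormalWord X} (hl : IsLead s l) :
    s - AC.mono l ∈ AC.below k l ∧ ∃ u v w, IsNLSW u ∧ IsNLSW v ∧ IsNLSW w ∧ LexGT u v ∧
      LexGT v w ∧ l.1 = .mul (.mul u v) w ∧
      s = AC.jacobian (AC.ofWord u) (AC.ofWord v) (AC.ofWord w) := by
  obtain ⟨u, v, w, hu, hv, hw, huv, hvw, rfl⟩ := hs
  have h := jacobian_sub_mem (k := k) hu hv hw huv hvw
  obtain rfl := AC.isLead_unique hl (AC.isLead_of_sub_mem h).1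
  exact ⟨h, u, v, w, hu, hv, hw, huv, hvw, rfl, rfl⟩

/-- Every normal word that is not an NLSW is the leading word of a normal `S₀`-word. -/
theorem exists_isNormalSWord [WellFoundedLT X] (w : NormalWord X) (hw : ¬ IsNLSW w.1) :
    ∃ p : AC k X, IsNormalSWord (jacobiansNLSW k X) p w ∧ p - AC.mono w ∈ AC.below k w := by
  obtain ⟨w, hN⟩ := w
  induction w using FreeMagma.rec with
  | of x => exact absurd trivial hw
  | mul x y ihx ihy =>
    -- The right factor is treated first: once $y$ is an NLSW, right multiplication by it preserves
    -- leading words, so the case of $x$ not an NLSW goes through.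
    by_cases hy : IsNLSW y
    · by_cases hx : IsNLSW x
      · have hxy := hx.wordLexGT hy hN.2.2
        cases x with
        | of z => exact absurd ⟨hx, hy, hxy, by rintro _ _ ⟨⟩⟩ hw
        | mul u v =>
          -- The last NLSW condition is the only one that can fail, so $v>y$ and the Jacobian of
          -- $u,v,y$ applies.
          have hvy : LexGT v y := by
            rcases wordLexGT_trichotomy (word v) (word y) with h | h | h
            · exact lexGT_of_wordLexGT h
            · exact absurd ⟨hx, hy, hxy, by rintro _ _ ⟨⟩; exact Or.inl h⟩ hw
            · exact absurd ⟨hx, hy, hxy, by rintro _ _ ⟨⟩; exact Or.inr h⟩ hw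
          have huv := lexGT_of_wordLexGT hx.2.2.1
          have h := jacobian_sub_mem (k := k) hx.1 hx.2.1 hy huv hvy
          exact ⟨_, ⟨_, ⟨u, v, y, hx.1, hx.2.1, hy, huv, hvy, rfl⟩, _,
            (AC.isLead_of_sub_mem h).1, .hole, rfl, rfl⟩, h⟩
      · obtain ⟨p, ⟨s, hs, l, hl, c, hc, rfl⟩, hp⟩ := ihx hN.1 hx
        refine ⟨_, ⟨s, hs, l, hl, .mulRight c y, congrArg (FreeMagma.mul · y) hc, rfl⟩, ?_⟩
        change AC.mul (c.eval s) (AC.ofWord y) - _ ∈ _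
        rw [AC.ofWord_of_isNormal hN.2.1]
        exact AC.mul_right_sub_mem hN.1 hN.2.1 hN hy hp
    · obtain ⟨p, ⟨s, hs, l, hl, c, hc, rfl⟩, hp⟩ := ihy hN.2.1 hy
      refine ⟨_, ⟨s, hs, l, hl, .mulLeft x c, congrArg (FreeMagma.mul x) hc, rfl⟩, ?_⟩
      change AC.mul (AC.ofWord x) (c.eval s) - _ ∈ _
      rw [AC.ofWord_of_isNormal hN.1]
      exact AC.mul_left_sub_mem hN.1 hN.2.1 hN hp

theorem mem_irr_jacobiansNLSW [WellFoundedLT X] (u : NormalWord X) :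
    u ∈ Irr (jacobiansNLSW k X) ↔ IsNLSW u.1 := by
  constructor
  · intro h
    by_contra hu
    obtain ⟨p, hp, -⟩ := exists_isNormalSWord (k := k) u hu
    exact h ⟨p, hp⟩
  · rintro h ⟨p, s, hs, l, hl, c, hc, -⟩
    obtain ⟨-, x, y, z, -, hy, hz, -, hyz, e, -⟩ := isLead_of_mem_jacobiansNLSW hs hl
    exact not_isNLSW_mul_mul hy hz hyz (e ▸ isNLSW_of_fill (hc ▸ h))

/-- The span of the NLSWs in `AC(X)`. -/
def nlswSpan (k X : Type*) [Field k] [LinearOrder X] : Submodule k (AC k X) :=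
  Submodule.span k (AC.mono '' {u : NormalWord X | IsNLSW u.1})

/-- Reduction of normal words modulo normal `S₀`-words, within a set of normal words that is
closed under passing to smaller words. -/
theorem mono_mem_span_sup_nlswSpan [WellFoundedLT X] {P : NormalWord X → Prop}
    (hP : ∀ u v : NormalWord X, P u → DegLexGT u.1 v.1 → P v) (u : NormalWord X) (hu : P u) :
    AC.mono u ∈
      Submodule.span k {p | ∃ v : NormalWord X, IsNormalSWord (jacobiansNLSW k X) p v ∧ P v} ⊔
        nlswSpan k X := by
  have wf := InvImage.wf (Subtype.val : NormalWord X → FreeMagma X)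
    (degLexGT_wellFounded (X := X))
  induction u using wf.induction with
  | _ u ih =>
  by_cases h : IsNLSW u.1
  · exact Submodule.mem_sup_right (Submodule.subset_span ⟨u, h, rfl⟩)
  · obtain ⟨p, hp, hb⟩ := exists_isNormalSWord (k := k) u h
    have h₁ := AC.below_le (fun v hv => ih v hv (hP u v hu hv)) hb
    have h₂ := Submodule.mem_sup_left (T := nlswSpan k X)
      (Submodule.subset_span (R := k)
        (s := {p | ∃ v : NormalWord X, IsNormalSWord (jacobiansNLSW k X) p v ∧ P v})
        ⟨u, hp, hu⟩)
    simpa using sub_mem h₂ h₁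

end Algebra


/-! ### Words and coefficients in the free associative algebra -/

noncomputable section FreeAssociative

variable {k X : Type*} [Field k]

/-- The element of the free associative algebra given by an associative word. -/
def assocMono (k : Type*) {X : Type*} [Field k] (w : List X) : MonoidAlgebra k (FreeMonoid X) :=
  MonoidAlgebra.single (FreeMonoid.ofList w) 1

theorem assocMono_mul (u v : List X) :
    assocMono k u * assocMono k v = assocMono k (u ++ v) := by
  simp [assocMono, MonoidAlgebra.single_mul_single, FreeMonoid.ofList_append]

/-- The coefficient of a word, as a linear functional. -/
def assocCoeff (k : Type*) {X : Type*} [Field k] (w : List X) :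
    MonoidAlgebra k (FreeMonoid X) →ₗ[k] k :=
  Finsupp.lapply (FreeMonoid.ofList w) ∘ₗ (MonoidAlgebra.coeffLinearEquiv k).toLinearMap

theorem assocCoeff_self (w : List X) : assocCoeff k w (assocMono k w) = 1 := by
  simp [assocCoeff, assocMono]

theorem assocCoeff_of_ne {w z : List X} (h : z ≠ w) : assocCoeff k w (assocMono k z) = 0 := by
  simp [assocCoeff, assocMono, h]

theorem mul_mem_span_assocMono {A B C : Set (List X)} (h : ∀ a ∈ A, ∀ b ∈ B, a ++ b ∈ C)
    {f g : MonoidAlgebra k (FreeMonoid X)} (hf : f ∈ Submodule.span k (assocMono k '' A))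
    (hg : g ∈ Submodule.span k (assocMono k '' B)) :
    f * g ∈ Submodule.span k (assocMono k '' C) := by
  have := Submodule.mul_mem_mul hf hg
  rw [Submodule.span_mul_span] at this
  refine Submodule.span_mono ?_ this
  rintro _ ⟨_, ⟨a, ha, rfl⟩, _, ⟨b, hb, rfl⟩, rfl⟩
  exact ⟨a ++ b, h a ha b hb, (assocMono_mul a b).symm⟩

end FreeAssociative

/-! ### The map to the free Lie algebra, and independence of NLSWs -/

noncomputable section FreeLie

variable (k : Type*) {X : Type*} [Field k] [LinearOrder X]

/-- The canonical map from `AC(X)` to the free Lie algebra. -/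
def toLie : AC k X →ₗ[k] FreeLieAlgebra k X :=
  Finsupp.linearCombination k fun u => lieEval k u.1

@[simp] theorem toLie_mono (u : NormalWord X) : toLie k (AC.mono u) = lieEval k u.1 := by
  simp [toLie, AC.mono]

variable {k}

theorem toLie_mul (f g : AC k X) : toLie k (AC.mul f g) = ⁅toLie k f, toLie k g⁆ := by
  induction f using AC.mono_induction with
  | hm u =>
    induction g using AC.mono_induction with
    | hm v =>
      rw [AC.mul_mono_mono, toLie_mono, toLie_mono]
      unfold AC.monoMul
      split_ifs with h h'
      · simp [lieEval]
      · rw [map_neg, toLie_mono, lieEval, lie_skew]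
      · obtain e := ((lexGT_trichotomy u.1 v.1).resolve_left h).resolve_right h'
        rw [e, map_zero, lie_self]
    | h0 => simp
    | ha f g hf hg => simp only [map_add, hf, hg, lie_add]
    | hs c f hf => simp only [map_smul, hf, lie_smul]
  | h0 => simp
  | ha f g hf hg => simp only [map_add, LinearMap.add_apply, hf, hg, add_lie]
  | hs c f hf => simp only [map_smul, LinearMap.smul_apply, hf, smul_lie]

theorem toLie_jacobian (f g h : AC k X) : toLie k (AC.jacobian f g h) = 0 := by
  simp only [AC.jacobian, map_sub, toLie_mul]
  rw [leibniz_lie (toLie k f) (toLie k g) (toLie k h),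
    ← lie_skew (toLie k g) ⁅toLie k f, toLie k h⁆]
  abel

theorem AC.id_le {S : Set (AC k X)} {I : Submodule k (AC k X)} (h : S ⊆ I)
    (hI : ∀ f ∈ I, ∀ g : AC k X, AC.mul f g ∈ I ∧ AC.mul g f ∈ I) : AC.Id S ≤ I :=
  sInf_le ⟨h, hI⟩

theorem AC.subset_id (S : Set (AC k X)) : S ⊆ AC.Id S := by
  intro f hf
  rw [SetLike.mem_coe, AC.Id, Submodule.mem_sInf]
  exact fun I hI => hI.1 hf

theorem AC.mul_mem_id {S : Set (AC k X)} {f : AC k X} (hf : f ∈ AC.Id S) (g : AC k X) :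
    AC.mul f g ∈ AC.Id S ∧ AC.mul g f ∈ AC.Id S := by
  simp only [AC.Id, Submodule.mem_sInf] at *
  exact ⟨fun I hI => (hI.2 f (hf I hI) g).1, fun I hI => (hI.2 f (hf I hI) g).2⟩

theorem AC.eval_mem_id {S : Set (AC k X)} {s : AC k X} (hs : s ∈ AC.Id S) (c : Ctx X) :
    c.eval s ∈ AC.Id S := by
  induction c with
  | hole => exact hs
  | mulRight c v ih => exact (AC.mul_mem_id ih _).1
  | mulLeft v c ih => exact (AC.mul_mem_id ih _).2

theorem IsNormalSWord.mem_id {S : Set (AC k X)} {p : AC k X} {w : NormalWord X}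
    (h : IsNormalSWord S p w) : p ∈ AC.Id S := by
  obtain ⟨s, hs, l, -, c, -, rfl⟩ := h
  exact AC.eval_mem_id (AC.subset_id S hs) c

theorem id_jacobiansNLSW_le_ker : AC.Id (jacobiansNLSW k X) ≤ LinearMap.ker (toLie k) := by
  refine AC.id_le ?_ fun f hf g => ?_
  · rintro _ ⟨u, v, w, -, -, -, -, -, rfl⟩
    exact toLie_jacobian _ _ _
  · rw [LinearMap.mem_ker] at hf
    simp [toLie_mul, hf]

/-- The range is a Lie subalgebra containing the generators; the universal property maps $Lie(X)$
into it, and composing with the inclusion gives the identity. -/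
theorem range_toLie : LinearMap.range (toLie k : AC k X →ₗ[k] _) = ⊤ := by
  let L : LieSubalgebra k (FreeLieAlgebra k X) :=
    { LinearMap.range (toLie k : AC k X →ₗ[k] _) with
      lie_mem' := by
        rintro _ _ ⟨f, rfl⟩ ⟨g, rfl⟩
        exact ⟨AC.mul f g, toLie_mul f g⟩ }
  have hL : ∀ x, FreeLieAlgebra.of k x ∈ L := fun x => ⟨AC.mono ⟨.of x, trivial⟩, toLie_mono k _⟩
  let F : FreeLieAlgebra k X →ₗ⁅k⁆ L := FreeLieAlgebra.lift k fun x => ⟨_, hL x⟩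
  have hF : L.incl.comp F = LieHom.id := by
    refine FreeLieAlgebra.hom_ext fun x => ?_
    simp [F]
  refine eq_top_iff.2 fun z _ => ?_
  have : L.incl (F z) = z := LieHom.congr_fun hF z
  exact this ▸ (F z).2

section Associative

attribute [local instance] LieRing.ofAssociativeRing

/-- The map from the free Lie algebra to the free associative algebra. -/
def toAssoc (k X : Type*) [Field k] :
    FreeLieAlgebra k X →ₗ⁅k⁆ MonoidAlgebra k (FreeMonoid X) :=
  FreeLieAlgebra.lift k fun x => assocMono k [x]

/-- The span of the words of the length of `w` that follow `w`. -/
def after (k : Type*) {X : Type*} [Field k] [LinearOrder X] (w : List X) :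
    Submodule k (MonoidAlgebra k (FreeMonoid X)) :=
  Submodule.span k (assocMono k '' {z | w.length = z.length ∧ WordLexGT w z})

/-- The span of `w` and the words of the length of `w` that follow `w`. -/
def notBefore (k : Type*) {X : Type*} [Field k] [LinearOrder X] (w : List X) :
    Submodule k (MonoidAlgebra k (FreeMonoid X)) :=
  Submodule.span k (assocMono k '' {z | w.length = z.length ∧ (w = z ∨ WordLexGT w z)})

theorem assocMono_mem_notBefore (w : List X) : assocMono k w ∈ notBefore k w :=
  Submodule.subset_span ⟨w, ⟨rfl, Or.inl rfl⟩, rfl⟩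

theorem after_le_notBefore (w : List X) : after k w ≤ notBefore k w :=
  Submodule.span_mono (Set.image_mono fun _ h => ⟨h.1, Or.inr h.2⟩)

theorem mul_mem_after_left {u v : List X} {f g : MonoidAlgebra k (FreeMonoid X)}
    (hf : f ∈ after k u) (hg : g ∈ notBefore k v) : f * g ∈ after k (u ++ v) := by
  refine mul_mem_span_assocMono ?_ hf hg
  rintro a ⟨ha, h⟩ b ⟨hb, -⟩
  exact ⟨by simp [ha, hb], (h.diffGT ha.ge).wordLexGT_append _ _⟩

theorem mul_mem_after_right {u v : List X} {f g : MonoidAlgebra k (FreeMonoid X)}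
    (hf : f ∈ notBefore k u) (hg : g ∈ after k v) : f * g ∈ after k (u ++ v) := by
  refine mul_mem_span_assocMono ?_ hf hg
  rintro a ⟨ha, h⟩ b ⟨hb, h'⟩
  refine ⟨by simp [ha, hb], ?_⟩
  rcases h with rfl | h
  · exact wordLexGT_append_left _ h'
  · exact (h.diffGT ha.ge).wordLexGT_append _ _

theorem mul_mem_after_of_swap {u v : List X} (huv : WordLexGT (u ++ v) (v ++ u))
    {f g : MonoidAlgebra k (FreeMonoid X)} (hf : f ∈ notBefore k v)
    (hg : g ∈ notBefore k u) : f * g ∈ after k (u ++ v) := by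
  refine mul_mem_span_assocMono ?_ hf hg
  rintro a ⟨ha, h⟩ b ⟨hb, h'⟩
  refine ⟨by simp [ha, hb, add_comm], ?_⟩
  rcases h with rfl | h
  · rcases h' with rfl | h'
    · exact huv
    · exact huv.trans (wordLexGT_append_left _ h')
  · exact huv.trans ((h.diffGT ha.ge).wordLexGT_append _ _)

/-- The leading associative word of an NLSW is its underlying word. -/
theorem toAssoc_lieEval_sub_mem {u : FreeMagma X} (h : IsNLSW u) :
    toAssoc k X (lieEval k u) - assocMono k (word u) ∈ after k (word u) := by
  induction u using FreeMagma.rec with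
  | of x => simp [lieEval, toAssoc, word]
  | mul v w ihv ihw =>
    have hv := ihv h.1
    have hw := ihw h.2.1
    set f := toAssoc k X (lieEval k v)
    set g := toAssoc k X (lieEval k w)
    have hf : f ∈ notBefore k (word v) := by
      simpa using add_mem (after_le_notBefore _ hv) (assocMono_mem_notBefore (word v))
    have hg : g ∈ notBefore k (word w) := by
      simpa using add_mem (after_le_notBefore _ hw) (assocMono_mem_notBefore (word w))
    -- The commutator is $fg-gf$. The words of $gf$ are at most $wv$, which follows $vw$ because $w$
    -- is Lyndon and $v>w$.
    have e : toAssoc k X (lieEval k (.mul v w)) - assocMono k (word (.mul v w)) =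
        (f - assocMono k (word v)) * g + assocMono k (word v) * (g - assocMono k (word w)) -
          g * f := by
      rw [lieEval, LieHom.map_lie, LieRing.of_associative_ring_bracket]
      change f * g - g * f - assocMono k (word v ++ word w) = _
      rw [← assocMono_mul]
      noncomm_ring
    rw [e]
    exact sub_mem (add_mem (mul_mem_after_left hv hg)
      (mul_mem_after_right (assocMono_mem_notBefore _) hw))
      (mul_mem_after_of_swap
        (h.2.1.isLyndon.append_wordLexGT_append (word_ne_nil v) h.2.2.1) hg hf)

theorem assocCoeff_eq_zero {w v : List X} (h : ¬ WordLexGT v w)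
    {f : MonoidAlgebra k (FreeMonoid X)} (hf : f ∈ after k v) : assocCoeff k w f = 0 := by
  have : after k v ≤ LinearMap.ker (assocCoeff k w) := by
    refine Submodule.span_le.2 ?_
    rintro _ ⟨z, ⟨-, hz⟩, rfl⟩
    exact assocCoeff_of_ne (by rintro rfl; exact h hz)
  exact this hf

theorem linearIndependent_lieEval :
    LinearIndependent k
      (fun u : {u : FreeMagma X // IsNLSW u} => lieEval k u.1) := by
  rw [linearIndependent_iff]
  intro c hc
  by_contra hne
  -- In the lexicographic order on lists over the dual alphabet, smaller means `WordLexGT`. So $m$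
  -- has the first word in the support, and no other summand contributes to the coefficient of that
  -- word.
  obtain ⟨m, hm, hmin⟩ := Set.Finite.exists_minimalFor
    (fun u : {u : FreeMagma X // IsNLSW u} => (word u.1 : List Xᵒᵈ)) c.support
    c.support.finite_toSet (Finsupp.support_nonempty_iff.2 hne)
  have hmin' : ∀ u ∈ c.support, u ≠ m → ¬ WordLexGT (word u.1) (word m.1) ∧
      word u.1 ≠ word m.1 := by
    intro u hu hum
    refine ⟨fun h => ?_, fun h => hum (Subtype.ext (u.2.eq_of_word_eq m.2 h))⟩
    have h' : (word u.1 : List Xᵒᵈ) < (word m.1 : List Xᵒᵈ) := h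
    exact absurd (hmin hu h'.le) (not_le_of_gt h')
  have h₀ := congrArg (fun z => assocCoeff k (word m.1) (toAssoc k X z)) hc
  have h₁ : ∀ u ∈ c.support, u ≠ m →
      assocCoeff k (word m.1) (toAssoc k X (lieEval k u.1)) = 0 := by
    intro u hu hum
    have := assocCoeff_eq_zero (hmin' u hu hum).1 (toAssoc_lieEval_sub_mem (k := k) u.2)
    rwa [map_sub, assocCoeff_of_ne (hmin' u hu hum).2, sub_zero] at this
  have h₂ : assocCoeff k (word m.1) (toAssoc k X (lieEval k m.1)) = 1 := by
    have := assocCoeff_eq_zero (wordLexGT_irrefl _) (toAssoc_lieEval_sub_mem (k := k) m.2)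
    rwa [map_sub, assocCoeff_self, sub_eq_zero] at this
  simp only [Finsupp.linearCombination_apply, Finsupp.sum, map_sum, map_zero] at h₀
  rw [Finset.sum_eq_single_of_mem m hm] at h₀
  · simp only [map_smul, h₂, smul_eq_mul, mul_one] at h₀
    exact Finsupp.mem_support_iff.1 hm h₀
  · intro u hu hum
    simp only [map_smul, h₁ u hu hum, smul_zero]

end Associative

end FreeLie


/-! ### Equality of the ideals, the basis, and the Gröbner–Shirshov property -/

noncomputable section Main

variable {k X : Type*} [Field k] [LinearOrder X]

theorem mul_injective {Y : Type*} {a b c d : FreeMagma Y}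
    (h : FreeMagma.mul a b = FreeMagma.mul c d) : a = c ∧ b = d := by
  injection h with h₁ h₂
  exact ⟨h₁, h₂⟩

namespace AC

theorem jacobian_swap_right (f g h : AC k X) : jacobian f g h = - jacobian f h g := by
  simp only [jacobian]
  rw [mul_swap g h, map_neg]
  abel

theorem jacobian_swap_left (f g h : AC k X) : jacobian f g h = - jacobian g f h := by
  simp only [jacobian]
  rw [mul_swap g f, mul_swap g (mul f h), mul_swap f (mul g h)]
  simp only [map_neg, LinearMap.neg_apply]
  abel

/-- In characteristic two this does not follow from antisymmetry; it needs $gg=0$. -/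
theorem jacobian_self_right (f g : AC k X) : jacobian f g g = 0 := by
  simp [jacobian, mul_self]

theorem jacobian_self_left (f g : AC k X) : jacobian f f g = 0 := by
  simp only [jacobian]
  rw [mul_self, mul_swap f (mul f g)]
  simp

/-- The Jacobian as a trilinear map. -/
def jacobianₗ : AC k X →ₗ[k] AC k X →ₗ[k] AC k X →ₗ[k] AC k X :=
  LinearMap.mk₂ k (fun f g => mul (mul f g) - mul.flip g ∘ₗ mul f - mul f ∘ₗ mul g)
    (fun f f' g => LinearMap.ext fun h => by simp; abel)
    (fun c f g => LinearMap.ext fun h => by simp [smul_sub])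
    (fun f g g' => LinearMap.ext fun h => by simp; abel)
    (fun c f g => LinearMap.ext fun h => by simp [smul_sub])

theorem jacobianₗ_apply (f g h : AC k X) : jacobianₗ f g h = jacobian f g h := rfl

end AC

theorem jacobian_mono_mem_of_chain {u v w : FreeMagma X} (hu : IsNLSW u) (hv : IsNLSW v)
    (hw : IsNLSW w) (huv : LexGT u v) (hvw : LexGT v w) :
    AC.jacobian (AC.mono ⟨u, hu.isNormal⟩) (AC.mono ⟨v, hv.isNormal⟩)
      (AC.mono ⟨w, hw.isNormal⟩) ∈ AC.Id (jacobiansNLSW k X) := by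
  rw [← AC.ofWord_of_isNormal hu.isNormal, ← AC.ofWord_of_isNormal hv.isNormal,
    ← AC.ofWord_of_isNormal hw.isNormal]
  exact AC.subset_id _ ⟨u, v, w, hu, hv, hw, huv, hvw, rfl⟩

theorem jacobian_mono_mem_of_left {u v w : FreeMagma X} (hu : IsNLSW u) (hv : IsNLSW v)
    (hw : IsNLSW w) (huv : LexGT u v) :
    AC.jacobian (AC.mono ⟨u, hu.isNormal⟩) (AC.mono ⟨v, hv.isNormal⟩)
      (AC.mono ⟨w, hw.isNormal⟩) ∈ AC.Id (jacobiansNLSW k X) := by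
  rcases lexGT_trichotomy v w with hvw | rfl | hwv
  · exact jacobian_mono_mem_of_chain hu hv hw huv hvw
  · rw [AC.jacobian_self_right]
    exact zero_mem _
  · rw [AC.jacobian_swap_right]
    refine neg_mem ?_
    rcases lexGT_trichotomy u w with huw | rfl | hwu
    · exact jacobian_mono_mem_of_chain hu hw hv huw hwv
    · rw [AC.jacobian_self_left]
      exact zero_mem _
    · rw [AC.jacobian_swap_left]
      exact neg_mem (jacobian_mono_mem_of_chain hw hu hv hwu huv)

theorem jacobian_mono_mem {u v w : FreeMagma X} (hu : IsNLSW u) (hv : IsNLSW v)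
    (hw : IsNLSW w) :
    AC.jacobian (AC.mono ⟨u, hu.isNormal⟩) (AC.mono ⟨v, hv.isNormal⟩)
      (AC.mono ⟨w, hw.isNormal⟩) ∈ AC.Id (jacobiansNLSW k X) := by
  rcases lexGT_trichotomy u v with huv | rfl | hvu
  · exact jacobian_mono_mem_of_left hu hv hw huv
  · rw [AC.jacobian_self_left]
    exact zero_mem _
  · rw [AC.jacobian_swap_left]
    exact neg_mem (jacobian_mono_mem_of_left hv hu hw hvu)

theorem jacobian_mem_of_mem_id {S : Set (AC k X)} {f : AC k X} (hf : f ∈ AC.Id S)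
    (g h : AC k X) : AC.jacobian f g h ∈ AC.Id S :=
  sub_mem (sub_mem (AC.mul_mem_id (AC.mul_mem_id hf _).1 _).1
    (AC.mul_mem_id (AC.mul_mem_id hf _).1 _).1) (AC.mul_mem_id hf _).1

theorem span_normalSWord_le_id (S : Set (AC k X)) (P : NormalWord X → Prop) :
    Submodule.span k {p | ∃ v : NormalWord X, IsNormalSWord S p v ∧ P v} ≤ AC.Id S := by
  refine Submodule.span_le.2 ?_
  rintro p ⟨v, hp, -⟩
  exact hp.mem_id

theorem eq_zero_of_mem_nlswSpan {f : AC k X} (hf : f ∈ nlswSpan k X) (h : toLie k f = 0) :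
    f = 0 := by
  have hs : nlswSpan k X = Submodule.span k (Set.range
      fun u : {u : FreeMagma X // IsNLSW u} => AC.mono ⟨u.1, u.2.isNormal⟩) := by
    rw [nlswSpan]
    congr 1
    ext x
    constructor
    · rintro ⟨u, hu, rfl⟩
      exact ⟨⟨u.1, hu⟩, rfl⟩
    · rintro ⟨u, rfl⟩
      exact ⟨⟨u.1, u.2.isNormal⟩, u.2, rfl⟩
  rw [hs] at hf
  obtain ⟨c, rfl⟩ := Finsupp.mem_span_range_iff_exists_finsupp.1 hf
  have hc : c = 0 := by
    refine linearIndependent_iff.1 (linearIndependent_lieEval (k := k) (X := X)) c ?_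
    rw [← h, Finsupp.linearCombination_apply, map_finsuppSum]
    simp
  simp [hc]

theorem jacobiansNLSW_nonempty [Nontrivial X] : (jacobiansNLSW k X).Nonempty := by
  obtain ⟨a, b, hab⟩ := exists_pair_lt X
  have hba : WordLexGT [b] [a] := List.Lex.rel hab
  -- For letters $b>a$ the chain is $b>ba>a$, the first step because a proper prefix is larger.
  exact ⟨_, .of b, .mul (.of b) (.of a), .of a, trivial,
    ⟨trivial, trivial, hba, by rintro _ _ ⟨⟩⟩, trivial,
    wordLexGT_append_right [b] (z := [a]) (by simp), (List.Lex.rel hab : WordLexGT [b, a] [a]),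
    rfl⟩

variable [WellFoundedLT X]

theorem id_sup_nlswSpan : AC.Id (jacobiansNLSW k X) ⊔ nlswSpan k X = ⊤ := by
  refine eq_top_iff.2 fun f _ => ?_
  induction f using AC.mono_induction with
  | hm u =>
    exact (sup_le_sup_right (span_normalSWord_le_id (jacobiansNLSW k X) fun _ => True) _ :)
      (mono_mem_span_sup_nlswSpan (P := fun _ => True) (fun _ _ _ _ => trivial) u trivial)
  | h0 => exact zero_mem _
  | ha f g hf hg => exact add_mem (hf trivial) (hg trivial)
  | hs c f hf => exact Submodule.smul_mem _ c (hf trivial)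

/-- When one argument lies in the ideal, so does the Jacobian. Trilinearity and `id_sup_nlswSpan`
therefore leave only NLSW arguments, which can be sorted. -/
theorem jacobian_mem_id (f g h : AC k X) :
    AC.jacobian f g h ∈ AC.Id (jacobiansNLSW k X) := by
  set I := AC.Id (jacobiansNLSW k X)
  have key : ∀ M : Submodule k (AC k X), I ≤ M →
      (∀ u (hu : IsNLSW u), AC.mono ⟨u, hu.isNormal⟩ ∈ M) → ∀ x, x ∈ M := by
    intro M hI hM x
    have : (⊤ : Submodule k (AC k X)) ≤ M := by
      rw [← id_sup_nlswSpan, sup_le_iff]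
      refine ⟨hI, Submodule.span_le.2 ?_⟩
      rintro _ ⟨u, hu, rfl⟩
      exact hM u.1 hu
    exact this trivial
  have h₁ (u) (hu : IsNLSW u) (v) (hv : IsNLSW v) (h : AC k X) :
      AC.jacobian (AC.mono ⟨u, hu.isNormal⟩) (AC.mono ⟨v, hv.isNormal⟩) h ∈ I :=
    key (I.comap (AC.jacobianₗ (AC.mono ⟨u, hu.isNormal⟩) (AC.mono ⟨v, hv.isNormal⟩)))
      (fun x hx => by
        rw [Submodule.mem_comap, AC.jacobianₗ_apply, AC.jacobian_swap_right,
          AC.jacobian_swap_left, neg_neg]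
        exact jacobian_mem_of_mem_id hx _ _)
      (fun w hw => jacobian_mono_mem hu hv hw) h
  have h₂ (u) (hu : IsNLSW u) (g h : AC k X) :
      AC.jacobian (AC.mono ⟨u, hu.isNormal⟩) g h ∈ I :=
    key (I.comap ((AC.jacobianₗ (AC.mono ⟨u, hu.isNormal⟩)).flip h))
      (fun x hx => by
        rw [Submodule.mem_comap, LinearMap.flip_apply, AC.jacobianₗ_apply,
          AC.jacobian_swap_left]
        exact neg_mem (jacobian_mem_of_mem_id hx _ _))
      (fun v hv => h₁ u hu v hv h) g
  exact key (I.comap ((AC.jacobianₗ.flip g).flip h))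
    (fun x hx => jacobian_mem_of_mem_id hx _ _) (fun u hu => h₂ u hu g h) f

theorem id_jacobiansNLSW : AC.Id (jacobiansNLSW k X) = AC.Id (jacobians k X) := by
  refine le_antisymm (AC.id_le ?_ fun f hf g => AC.mul_mem_id hf g)
    (AC.id_le ?_ fun f hf g => AC.mul_mem_id hf g)
  · rintro _ ⟨u, v, w, hu, hv, hw, huv, hvw, rfl⟩
    rw [AC.ofWord_of_isNormal hu.isNormal, AC.ofWord_of_isNormal hv.isNormal,
      AC.ofWord_of_isNormal hw.isNormal]
    exact AC.subset_id _ ⟨⟨u, hu.isNormal⟩, ⟨v, hv.isNormal⟩, ⟨w, hw.isNormal⟩, huv, hvw, rfl⟩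
  · rintro _ ⟨u, v, w, -, -, rfl⟩
    exact jacobian_mem_id _ _ _

theorem span_lieEval :
    Submodule.span k (Set.range fun u : {u : FreeMagma X // IsNLSW u} => lieEval k u.1) = ⊤ := by
  rw [eq_top_iff, ← range_toLie, LinearMap.range_eq_map, ← id_sup_nlswSpan, Submodule.map_sup,
    sup_le_iff]
  constructor
  · rw [LinearMap.le_ker_iff_map.1 id_jacobiansNLSW_le_ker]
    exact bot_le
  · rw [nlswSpan, Submodule.map_span, Submodule.span_le]
    rintro _ ⟨_, ⟨u, hu, rfl⟩, rfl⟩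
    exact Submodule.subset_span ⟨⟨u.1, hu⟩, (toLie_mono k u).symm⟩

/-- The Composition-Diamond step: an element of the ideal whose words are smaller than `w` is
trivial modulo `(S₀, w)`. -/
theorem trivialMod_of_mem_below {w : NormalWord X} {f : AC k X} (hb : f ∈ AC.below k w)
    (hf : f ∈ AC.Id (jacobiansNLSW k X)) : TrivialMod (jacobiansNLSW k X) w f := by
  -- Being below $w$ is inherited by smaller words, so every normal $S_0$-word used in the reduction
  -- stays below $w$.
  have h := AC.below_le (fun v hv => mono_mem_span_sup_nlswSpan (k := k)
    (P := fun v => DegLexGT w.1 v.1) (fun _ _ h₁ h₂ => h₁.trans h₂) v hv) hb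
  obtain ⟨a, ha, b, hbN, rfl⟩ := Submodule.mem_sup.1 h
  -- The NLSW remainder is in the ideal, hence zero in $Lie(X)$, and independence makes it zero in
  -- $AC(X)$.
  have hbI : b ∈ AC.Id (jacobiansNLSW k X) := by
    simpa using sub_mem hf (span_normalSWord_le_id _ _ ha)
  rwa [eq_zero_of_mem_nlswSpan hbN (id_jacobiansNLSW_le_ker hbI), add_zero]

theorem isGSB_jacobiansNLSW : IsGSB (jacobiansNLSW k X) := by
  refine ⟨?_, ?_⟩
  · rintro _ ⟨u, v, w, hu, hv, hw, huv, hvw, rfl⟩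
    exact ⟨_, AC.isLead_of_sub_mem (jacobian_sub_mem hu hv hw huv hvw)⟩
  · rintro f hf g hg W p hfW ⟨s, rfl, l, hl, c, hc, rfl⟩
    obtain ⟨hfb, u, v, w, hu, hv, hw, huv, hvw, hW, -⟩ := isLead_of_mem_jacobiansNLSW hf hfW
    obtain ⟨hsb, u', v', w', hu', hv', hw', huv', hvw', hl', -⟩ :=
      isLead_of_mem_jacobiansNLSW hg hl
    -- Subwords of NLSWs are NLSWs, so $l$ cannot sit inside $u$, $v$ or $w$. Within $(uv)w$ it is
    -- the whole word or the factor $uv$.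
    have hlN : ¬ IsNLSW l.1 := hl' ▸ not_isNLSW_mul_mul hv' hw' hvw'
    refine trivialMod_of_mem_below ?_ (sub_mem (AC.subset_id _ hf)
      (AC.eval_mem_id (AC.subset_id _ hg) c))
    suffices hp : c.eval s - AC.mono W ∈ AC.below k W by simpa using sub_mem hfb hp
    obtain ⟨W, hWN⟩ := W
    obtain rfl : W = _ := hW
    cases c with
    | hole =>
      obtain rfl : l = ⟨_, hWN⟩ := Subtype.ext hc
      exact hsb
    | mulLeft x c =>
      obtain ⟨-, hc⟩ := mul_injective hc
      exact absurd (isNLSW_of_fill (hc ▸ hw)) hlN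
    | mulRight c x =>
      obtain ⟨hc₁, rfl⟩ := mul_injective hc
      cases c with
      | mulLeft y c =>
        obtain ⟨-, hc₂⟩ := mul_injective hc₁
        exact absurd (isNLSW_of_fill (hc₂ ▸ hv)) hlN
      | mulRight c y =>
        obtain ⟨hc₂, -⟩ := mul_injective hc₁
        exact absurd (isNLSW_of_fill (hc₂ ▸ hu)) hlN
      | hole =>
        obtain rfl : l = ⟨_, hWN.1⟩ := Subtype.ext hc₁
        change AC.mul s (AC.ofWord _) - _ ∈ _
        rw [AC.ofWord_of_isNormal hWN.2.1]
        exact AC.mul_right_sub_mem hWN.1 hWN.2.1 hWN hw hsb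

end Main

end LyndonShirshov

theorem theorem4p6 (k : Type*) [Field k] (X : Type*) [LinearOrder X] [WellFoundedLT X] :
    -- `S₀` is a Gröbner–Shirshov basis (and it is non-empty as soon as `X` has two letters)
    LyndonShirshov.IsGSB (LyndonShirshov.jacobiansNLSW k X) ∧
    (Nontrivial X → (LyndonShirshov.jacobiansNLSW k X).Nonempty) ∧
    -- `Id(S₀) = Id(S)`
    LyndonShirshov.AC.Id (LyndonShirshov.jacobiansNLSW k X) =
      LyndonShirshov.AC.Id (LyndonShirshov.jacobians k X) ∧
    -- `Irr(S₀)` is the set of all non-associative Lyndon–Shirshov words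
    Subtype.val '' LyndonShirshov.Irr (LyndonShirshov.jacobiansNLSW k X) =
      {u : FreeMagma X | LyndonShirshov.IsNLSW u} ∧
    -- these words form a linear basis of the free Lie algebra
    LinearIndependent k
      (fun u : {u : FreeMagma X // LyndonShirshov.IsNLSW u} =>
        LyndonShirshov.lieEval k u.1) ∧
    Submodule.span k
      (Set.range fun u : {u : FreeMagma X // LyndonShirshov.IsNLSW u} =>
        LyndonShirshov.lieEval k u.1) = ⊤ :=
  ⟨LyndonShirshov.isGSB_jacobiansNLSW, fun _ => LyndonShirshov.jacobiansNLSW_nonempty,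
    LyndonShirshov.id_jacobiansNLSW, by
      ext u
      constructor
      · rintro ⟨v, hv, rfl⟩
        exact (LyndonShirshov.mem_irr_jacobiansNLSW v).1 hv
      · intro hu
        exact ⟨⟨u, hu.isNormal⟩, (LyndonShirshov.mem_irr_jacobiansNLSW _).2 hu, rfl⟩,
    LyndonShirshov.linearIndependent_lieEval, LyndonShirshov.span_lieEval⟩
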